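/- Let $l\ge 3$ be a prime, let $\mathbb F_q$ be a finite field with $q\equiv 1\pmod{2l^2}$ elements, and let $\gamma$ be a generator of $\mathbb F_q^*$. Let $\zeta$ be a primitive $2l^2$-th root of unity in $\mathbb C$ (for example $e^{2\pi i/2l^2}$), put $\zeta_{l^2}=\zeta^2$, let $\chi$ be the multiplicative character of $\mathbb F_q$ with $\chi(\gamma)=\zeta$ and $\chi(0)=0$, and put $$J_{2l^2}(1,n)=\sum_{v\in\mathbb F_q}\chi(v)\,\chi^n(v+1).$$ Let $w=\operatorname{ind}_\gamma 2$, i.e. $\gamma^w=2$ in $\mathbb F_q$. For integers $a,b$ let $(a,b)_{l^2}$ be the cyclotomic number of order $l^2$, i.e. the number of $v\in\mathbb F_q\setminus\{0,-1\}$ with $\operatorname{ind}_\gamma v\equiv a$ and $\operatorname{ind}_\gamma (v+1)\equiv b\pmod{l^2}$, and let $$B(i,j)=\sum_{h=0}^{l^2-1}(h,\,i-jh)_{l^2}$$ be the Dickson–Hurwitz sums of order $l^2$. For an integer $m$ put $$c_{i,m}=\sum_{k=0}^{l^2-1}\binom{k}{i}B(k,m)\quad(3\le i\le l-1),\qquad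 c_{l,m}=\sum_{t=0}^{l-1}\sum_{j=0}^{l-1}t\,B(lt+j,m),$$ $$C_m(x)=-1+\sum_{i=3}^{l}c_{i,m}(x-1)^i .$$ Let $n$ be an odd integer with $1\le n\le 2l^2-3$. Then, in the ring $\mathbb Z[\zeta_{l^2}]$ and modulo $(1-\zeta_{l^2})^{l+1}$: 1. if $n=l^2$, then $$J_{2l^2}(1,n)\equiv \zeta_{l^2}^{-w}\,C_{(l^2-1)/2}(\zeta_{l^2});$$ 2. if $n=dl$ with $d$ odd and $d\ne l$, then $$J_{2l^2}(1,n)\equiv -\zeta_{l^2}^{-w(dl+1)}\,C_{(l^2-1)/2}(\zeta_{l^2})\,C_{dl-1}\bigl(\zeta_{l^2}^{(-1-dl)/2}\bigr);$$ 3. if $\gcd(n,2l^2)=1$, then $$J_{2l^2}(1,n)\equiv \zeta_{l^2}^{-w(n+1)}\,C_{(l^2-1)/2}(\zeta_{l^2})\,C_{(l^2-1)/2}(\zeta_{l^2}^{\,n})\,C_{n}\bigl(\zeta_{l^2}^{(1-l^2)/2}\bigr).$$ -/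

import Mathlib

open scoped BigOperators

noncomputable section

/-- The Jacobi sum `J(i, j) = ∑ v, χ^i(v) χ^j(v + 1)` attached to a multiplicative character `χ`
of a finite field (every power of `χ`, including `χ^0`, vanishes at `0`). -/
def jacobiSumPlus {F : Type*} [Field F] [Fintype F] (χ : MulChar F ℂ) (i j : ℕ) : ℂ :=
  ∑ v : F, (χ ^ i) v * (χ ^ j) (v + 1)

/-- The cyclotomic number `(a, b)_e` with respect to the generator `γ`: the number of `v` in the
class `{γ^(e s + a)}` such that `v + 1` lies in the class `{γ^(e t + b)}`. -/
def cyclotomicNumber {F : Type*} [Field F] (e : ℕ) (γ : Fˣ) (a b : ℤ) : ℕ :=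
  Set.ncard {v : F | (∃ s : ℤ, v = ((γ ^ ((e : ℤ) * s + a) : Fˣ) : F)) ∧
    ∃ t : ℤ, v + 1 = ((γ ^ ((e : ℤ) * t + b) : Fˣ) : F)}

/-- The Dickson-Hurwitz sum `B_e(i, j) = ∑_{h = 0}^{e - 1} (h, i - j h)_e`. -/
def dicksonHurwitz {F : Type*} [Field F] (e : ℕ) (γ : Fˣ) (i j : ℤ) : ℤ :=
  ∑ h ∈ Finset.range e, (cyclotomicNumber e γ (h : ℤ) (i - j * (h : ℤ)) : ℤ)

/-- The coefficients `c_{i,n}` of the expansion of the Jacobi sum `J(1, n)` of order `l ^ 2` in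
powers of `ζ - 1`, where `ζ` is a primitive `l ^ 2`-th root of unity:
`c_{i,n} = ∑_k (k choose i) B_{l²}(k, n)` for `i < l`, and
`c_{l,n} = S(n) = ∑_t ∑_j t B_{l²}(l t + j, n)`. -/
def jacobiCoeff {F : Type*} [Field F] (l : ℕ) (γ : Fˣ) (i : ℕ) (n : ℤ) : ℤ :=
  if i = l then
    ∑ t ∈ Finset.range l, ∑ j ∈ Finset.range l,
      (t : ℤ) * dicksonHurwitz (l ^ 2) γ ((l : ℤ) * (t : ℤ) + (j : ℤ)) n
  else
    ∑ k ∈ Finset.range (l ^ 2), (k.choose i : ℤ) * dicksonHurwitz (l ^ 2) γ (k : ℤ) n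

/-- The factor `-1 + ∑_{i = 3}^{l} c_{i,n} (x - 1)^i`. -/
def jacobiFactor {F : Type*} [Field F] (l : ℕ) (γ : Fˣ) (n : ℤ) (x : ℂ) : ℂ :=
  -1 + ∑ i ∈ Finset.Icc 3 l, (jacobiCoeff l γ i n : ℂ) * (x - 1) ^ i

/-- `a ≡ b` modulo `m` in the ring `ℤ[ξ]`. -/
def CongrInAdjoin (ξ m a b : ℂ) : Prop :=
  ∃ t ∈ Algebra.adjoin ℤ ({ξ} : Set ℂ), a - b = m * t

end

/-! Write `χ = η * φ` with `η = χ ^ l²` quadratic and `φ = χ ^ (l² + 1)` of order `l²`. Square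
counting gives the duplication formula J(a, η) = a(4) J(a, a). Combined with Gauss sums, it
expresses q·J(ηa, ηb) as (a(4)b(4))⁻¹ times J(a, b) J(a⁻¹, a⁻¹) J(b⁻¹, b⁻¹)
(`card_mul_shiftedJacobiSum_twist`), so only characters of order dividing `l²` remain. The value
φ(4) = ξ^w produces the powers of ξ, and q drops out because (1 - ξ)^(l+1) divides l, which divides
q - 1.

A Jacobi sum of order dividing `l²` is a sum of powers x^k; expanding each in powers of x - 1 makes
the i-th coefficient a sum of binomials C(k, i). Modulo l, the coefficient at 0 is q - 2 ≡ -1, those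
at 1 and 2 vanish by symmetry of discrete logarithms, and the rest are the c_{i,m}, with Lucas'
theorem at i = l (`sum_pow_jacobiExponent`). -/

/-! ### Jacobi sums and the quadratic twist. -/

section Characters

variable {F : Type*} [Field F] [Fintype F]

/-- The Jacobi sum `∑ v, a(v) b(v + 1)` of two multiplicative characters. -/
noncomputable def shiftedJacobiSum (a b : MulChar F ℂ) : ℂ := ∑ v : F, a v * b (v + 1)

lemma shiftedJacobiSum_eq_jacobiSum (a b : MulChar F ℂ) :
    shiftedJacobiSum a b = a (-1) * jacobiSum a b := by
  rw [shiftedJacobiSum, jacobiSum, ← Equiv.sum_comp (Equiv.neg F), Finset.mul_sum]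
  refine Finset.sum_congr rfl fun v _ ↦ ?_
  rw [Equiv.neg_apply, neg_eq_neg_one_mul v, map_mul, mul_assoc, neg_one_mul, neg_add_eq_sub]

lemma shiftedJacobiSum_comm {a b : MulChar F ℂ} (ha : a (-1) = 1) (hb : b (-1) = 1) :
    shiftedJacobiSum a b = shiftedJacobiSum b a := by
  rw [shiftedJacobiSum_eq_jacobiSum, shiftedJacobiSum_eq_jacobiSum, ha, hb, jacobiSum_comm]

/-- Substitute v ↦ v⁻¹ and use v⁻¹ + 1 = v⁻¹(v + 1). -/
lemma shiftedJacobiSum_eq_inv_mul (a b : MulChar F ℂ) :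
    shiftedJacobiSum a b = shiftedJacobiSum (a * b)⁻¹ b := by
  rw [shiftedJacobiSum, shiftedJacobiSum,
    ← Equiv.sum_comp (inv_involutive (G := F)).toPerm]
  refine Finset.sum_congr rfl fun v _ ↦ ?_
  rcases eq_or_ne v 0 with rfl | hv
  · simp [MulChar.map_zero]
  · have h : v⁻¹ + 1 = v⁻¹ * (v + 1) := by field_simp; ring
    rw [Function.Involutive.coe_toPerm, h, map_mul, MulChar.inv_apply', MulChar.mul_apply, mul_assoc]

variable (F) in
/-- The quadratic character of a finite field with complex values. -/
noncomputable def complexQuadraticChar : MulChar F ℂ := by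
  classical exact (quadraticChar F).ringHomComp (Int.castRingHom ℂ)

lemma complexQuadraticChar_isQuadratic : (complexQuadraticChar F).IsQuadratic := by
  classical exact (quadraticChar_isQuadratic F).comp _

lemma complexQuadraticChar_ne_one (hF : ringChar F ≠ 2) : complexQuadraticChar F ≠ 1 := by
  classical
  exact (MulChar.ringHomComp_ne_one_iff (RingHom.injective_int _)).mpr (quadraticChar_ne_one hF)

lemma eq_complexQuadraticChar (hF : ringChar F ≠ 2) {γ : Fˣ}
    (hγ : ∀ x : Fˣ, x ∈ Subgroup.zpowers γ) {η : MulChar F ℂ} (hη : η γ = -1) :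
    η = complexQuadraticChar F := by
  rw [MulChar.eq_iff hγ, hη]
  rcases complexQuadraticChar_isQuadratic (γ : F) with h | h | h
  · exact absurd h ((γ.isUnit.map (complexQuadraticChar F)).ne_zero)
  · refine absurd ?_ (complexQuadraticChar_ne_one hF)
    rw [MulChar.eq_iff hγ, h, MulChar.one_apply_coe]
  · exact h.symm

/-- The number of square roots of `x` is `1 + η(x)`, so that a sum over squares can be rewritten
with the quadratic character. -/
lemma sum_comp_sq (hF : ringChar F ≠ 2) (f : F → ℂ) :
    ∑ s : F, f (s ^ 2) = ∑ x : F, f x * (complexQuadraticChar F x + 1) := by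
  classical
  rw [← Finset.sum_fiberwise_of_maps_to (s := Finset.univ) (t := Finset.univ)
    (g := fun s : F ↦ s ^ 2) (fun _ _ ↦ Finset.mem_univ _)]
  refine Finset.sum_congr rfl fun x _ ↦ ?_
  rw [Finset.sum_congr rfl (g := fun _ ↦ f x)
    (fun s hs ↦ by rw [(Finset.mem_filter.mp hs).2]), Finset.sum_const, nsmul_eq_mul, mul_comm]
  congr 1
  have h := quadraticChar_card_sqrts hF x
  have h2 : Set.toFinset {s : F | s ^ 2 = x} = ({s | s ^ 2 = x} : Finset F) := by
    ext; simp
  rw [h2] at h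
  have h3 := congrArg (Int.cast : ℤ → ℂ) h
  push_cast at h3
  rw [h3]
  simp [complexQuadraticChar]

/-- Counting square roots turns the left side into the sum of a(s² - 1), the extra term vanishing
because a is nontrivial. Then s = 2v + 1 gives s² - 1 = 4v(v + 1). -/
lemma shiftedJacobiSum_quadratic (hF : ringChar F ≠ 2) {a : MulChar F ℂ} (ha : a ≠ 1) :
    shiftedJacobiSum a (complexQuadraticChar F) = a 4 * shiftedJacobiSum a a := by
  have h2 : (2 : F) ≠ 0 := Ring.two_ne_zero hF
  have h := sum_comp_sq hF (fun x ↦ a (x - 1))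
  simp only [mul_add, mul_one, Finset.sum_add_distrib] at h
  have h0 : ∑ x : F, a (x - 1) = 0 :=
    (Equiv.sum_comp (Equiv.subRight (1 : F)) a).trans (MulChar.sum_eq_zero_of_ne_one ha)
  rw [h0, add_zero, ← Equiv.sum_comp (Equiv.addRight (1 : F)) (fun x ↦ a (x - 1) * _)] at h
  simp only [Equiv.coe_addRight, add_sub_cancel_right] at h
  rw [shiftedJacobiSum, ← h, shiftedJacobiSum, Finset.mul_sum,
    ← Equiv.sum_comp (Equiv.addRight (1 : F)), ← Equiv.sum_comp (Equiv.mulLeft₀ (2 : F) h2)]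
  refine Finset.sum_congr rfl fun v _ ↦ ?_
  rw [← map_mul, ← map_mul]
  congr 1
  simp only [Equiv.coe_addRight, Equiv.mulLeft₀_apply]
  ring

/-- A Jacobi sum of twists by the quadratic character, in terms of Jacobi sums of the original
characters. -/
lemma card_mul_shiftedJacobiSum_twist (hF : ringChar F ≠ 2) {a b : MulChar F ℂ}
    (ha2 : a * a ≠ 1) (hb2 : b * b ≠ 1) (hab : a * b ≠ 1) (ha1 : a (-1) = 1) (hb1 : b (-1) = 1) :
    (Fintype.card F : ℂ) *
        shiftedJacobiSum (complexQuadraticChar F * a) (complexQuadraticChar F * b) =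
      (a 4 * b 4)⁻¹ * (shiftedJacobiSum a b * shiftedJacobiSum a⁻¹ a⁻¹ *
        shiftedJacobiSum b⁻¹ b⁻¹) := by
  set η := complexQuadraticChar F with hη
  have hηq : η.IsQuadratic := complexQuadraticChar_isQuadratic
  have hηη : η * η = 1 := by rw [← sq, hηq.sq_eq_one]
  have ne_one {c : MulChar F ℂ} (h : c * c ≠ 1) : c ≠ 1 := fun hc ↦ h (by rw [hc, mul_one])
  have twist_ne {c : MulChar F ℂ} (h : c * c ≠ 1) : c * η ≠ 1 := fun hc ↦ h <| by
    calc c * c = c * c * (η * η) := by rw [hηη, mul_one]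
      _ = 1 := by rw [mul_mul_mul_comm, hc, mul_one]
  have hq : (Fintype.card F : ℂ) ≠ 0 := Nat.cast_ne_zero.mpr Fintype.card_ne_zero
  have hchar : ringChar ℂ ≠ ringChar F := by
    rw [CharP.ringChar_zero_iff_CharZero ℂ |>.mpr inferInstance]
    exact (CharP.ringChar_ne_zero_of_finite F).symm
  set ψ := AddChar.FiniteField.primitiveChar_to_Complex F
  have hψ : ψ.IsPrimitive := AddChar.FiniteField.primitiveChar_to_Complex_isPrimitive F
  have h4 (c : MulChar F ℂ) : c 4 ≠ 0 := by
    have : (4 : F) ≠ 0 := by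
      rw [show (4 : F) = 2 * 2 by norm_num]
      exact mul_ne_zero (Ring.two_ne_zero hF) (Ring.two_ne_zero hF)
    exact ((isUnit_iff_ne_zero.mpr this).map c).ne_zero
  have hηab : η * a * (η * b) = a * b := by rw [mul_mul_mul_comm, hηη, one_mul]
  have e1 := jacobiSum_mul_nontrivial (χ := η * a) (φ := η * b) (by rwa [hηab]) ψ
  rw [hηab] at e1
  have e2 := jacobiSum_mul_nontrivial hab ψ
  have e3 := jacobiSum_mul_nontrivial (twist_ne ha2) ψ
  have e4 := jacobiSum_mul_nontrivial (twist_ne hb2) ψ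
  have e5 := shiftedJacobiSum_quadratic hF (ne_one ha2)
  have e6 := shiftedJacobiSum_quadratic hF (ne_one hb2)
  have e7 := gaussSum_sq (complexQuadraticChar_ne_one hF) hηq hψ
  have e8 := jacobiSum_mul_jacobiSum_inv hchar (ne_one ha2) (ne_one ha2) ha2
  have e9 := jacobiSum_mul_jacobiSum_inv hchar (ne_one hb2) (ne_one hb2) hb2
  have hgab := gaussSum_ne_zero_of_nontrivial hq hab hψ
  have ha1' : a⁻¹ (-1) = 1 := by rw [MulChar.inv_apply_eq_inv', ha1, inv_one]
  have hb1' : b⁻¹ (-1) = 1 := by rw [MulChar.inv_apply_eq_inv', hb1, inv_one]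
  have hη1 : η (-1) * η (-1) = 1 := by rw [← map_mul]; simp
  simp only [shiftedJacobiSum_eq_jacobiSum, MulChar.mul_apply, ha1, hb1, ha1', hb1', one_mul,
    mul_one, ← hη] at e5 e6 e7 ⊢
  rw [mul_comm a η] at e3
  rw [mul_comm b η] at e4
  rw [e5] at e3
  rw [e6] at e4
  set J := jacobiSum (η * a) (η * b)
  set gab := gaussSum (a * b) ψ
  -- The duplication formula gives g(ηa) a(4) J(a, a) = g(a) g(η), and likewise for b; g(η)² = η(-1)
  -- q then links the two products of Gauss sums.
  have key : gab * (J * (a 4 * b 4) * (jacobiSum a a * jacobiSum b b)) =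
      gab * (jacobiSum a b * (η (-1) * Fintype.card F)) := by
    linear_combination (a 4 * b 4) * (jacobiSum a a * jacobiSum b b) * e1 +
      (gaussSum (η * b) ψ * (b 4 * jacobiSum b b)) * e3 + gaussSum a ψ * gaussSum η ψ * e4 +
      gaussSum a ψ * gaussSum b ψ * e7 - (η (-1) * Fintype.card F) * e2
  have key2 := mul_left_cancel₀ hgab key
  rw [eq_inv_mul_iff_mul_eq₀ (mul_ne_zero (h4 a) (h4 b))]
  refine mul_left_cancel₀ hq ?_
  -- J(c, c) J(c⁻¹, c⁻¹) = q for c = a, b trades the diagonal sums for those of the inverses.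
  linear_combination η (-1) * (jacobiSum a⁻¹ a⁻¹ * jacobiSum b⁻¹ b⁻¹) * key2 +
    (jacobiSum a b * Fintype.card F * jacobiSum a⁻¹ a⁻¹ * jacobiSum b⁻¹ b⁻¹) * hη1
    - η (-1) * J * (a 4 * b 4) * (Fintype.card F * e9 + jacobiSum b b * jacobiSum b⁻¹ b⁻¹ * e8)

end Characters

lemma sum_range_mul_eq {M : Type*} [AddCommMonoid M] (f : ℕ → M) (m l : ℕ) :
    ∑ k ∈ Finset.range (l * m), f k =
      ∑ t ∈ Finset.range m, ∑ j ∈ Finset.range l, f (l * t + j) := by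
  induction m with
  | zero => simp
  | succ m ih => rw [mul_add_one, Finset.sum_range_add, ih, Finset.sum_range_succ]

/-! ### Discrete logarithms modulo divisors of q - 1. -/

section DiscreteLog

variable {F : Type*} [Field F]

open Classical in
/-- An integer `k` with `γ ^ k = v`, if there is one, and `0` otherwise. -/
noncomputable def discreteLog (γ : Fˣ) (v : F) : ℤ :=
  if h : ∃ k : ℤ, ((γ ^ k : Fˣ) : F) = v then h.choose else 0

lemma discreteLog_zero (γ : Fˣ) : discreteLog γ 0 = 0 :=
  dif_neg fun ⟨_, hk⟩ ↦ Units.ne_zero _ hk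

lemma zpow_discreteLog {γ : Fˣ} (hγ : ∀ x : Fˣ, x ∈ Subgroup.zpowers γ) {v : F} (hv : v ≠ 0) :
    ((γ ^ discreteLog γ v : Fˣ) : F) = v := by
  have h : ∃ k : ℤ, ((γ ^ k : Fˣ) : F) = v := by
    obtain ⟨k, hk⟩ := Subgroup.mem_zpowers_iff.mp (hγ (Units.mk0 v hv))
    exact ⟨k, by rw [hk, Units.val_mk0]⟩
  rw [discreteLog, dif_pos h]
  exact h.choose_spec

variable [Fintype F]

lemma intCast_eq_of_zpow_eq {γ : Fˣ} (hγ : ∀ x : Fˣ, x ∈ Subgroup.zpowers γ) {e : ℕ}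
    (he : e ∣ Fintype.card F - 1) {a b : ℤ} (h : γ ^ a = γ ^ b) : (a : ZMod e) = b := by
  classical
  rw [ZMod.intCast_eq_intCast_iff]
  refine (zpow_eq_zpow_iff_modEq.mp h).of_dvd ?_
  rw [orderOf_eq_card_of_forall_mem_zpowers hγ, Nat.card_eq_fintype_card, Fintype.card_units]
  exact_mod_cast he

lemma discreteLog_zpow {γ : Fˣ} (hγ : ∀ x : Fˣ, x ∈ Subgroup.zpowers γ) {e : ℕ}
    (he : e ∣ Fintype.card F - 1) (k : ℤ) :
    (discreteLog γ ((γ ^ k : Fˣ) : F) : ZMod e) = k :=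
  intCast_eq_of_zpow_eq hγ he (Units.ext (zpow_discreteLog hγ (Units.ne_zero _)))

lemma discreteLog_mul {γ : Fˣ} (hγ : ∀ x : Fˣ, x ∈ Subgroup.zpowers γ) {e : ℕ}
    (he : e ∣ Fintype.card F - 1) {u v : F} (hu : u ≠ 0) (hv : v ≠ 0) :
    (discreteLog γ (u * v) : ZMod e) = discreteLog γ u + discreteLog γ v := by
  have h := discreteLog_zpow hγ he (discreteLog γ u + discreteLog γ v)
  rw [zpow_add, Units.val_mul, zpow_discreteLog hγ hu, zpow_discreteLog hγ hv] at h
  rw [h, Int.cast_add]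

lemma discreteLog_one {γ : Fˣ} (hγ : ∀ x : Fˣ, x ∈ Subgroup.zpowers γ) {e : ℕ}
    (he : e ∣ Fintype.card F - 1) : (discreteLog γ (1 : F) : ZMod e) = 0 := by
  simpa using discreteLog_zpow hγ he 0

lemma discreteLog_inv {γ : Fˣ} (hγ : ∀ x : Fˣ, x ∈ Subgroup.zpowers γ) {e : ℕ}
    (he : e ∣ Fintype.card F - 1) (v : F) :
    (discreteLog γ v⁻¹ : ZMod e) = -discreteLog γ v := by
  rcases eq_or_ne v 0 with rfl | hv
  · simp [discreteLog_zero]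
  · rw [eq_neg_iff_add_eq_zero, ← discreteLog_mul hγ he (inv_ne_zero hv) hv, inv_mul_cancel₀ hv,
      discreteLog_one hγ he]

lemma zpow_mul_add_iff {γ : Fˣ} (hγ : ∀ x : Fˣ, x ∈ Subgroup.zpowers γ) {e : ℕ}
    (he : e ∣ Fintype.card F - 1) (v : F) (a : ℤ) :
    (∃ s : ℤ, v = ((γ ^ ((e : ℤ) * s + a) : Fˣ) : F)) ↔
      v ≠ 0 ∧ (discreteLog γ v : ZMod e) = a := by
  constructor
  · rintro ⟨s, rfl⟩
    refine ⟨Units.ne_zero _, ?_⟩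
    rw [discreteLog_zpow hγ he]
    simp
  · rintro ⟨hv, h⟩
    rw [eq_comm, ZMod.intCast_eq_intCast_iff_dvd_sub] at h
    obtain ⟨s, hs⟩ := h
    refine ⟨s, ?_⟩
    rw [← hs, sub_add_cancel, zpow_discreteLog hγ hv]

/-! ### Dickson–Hurwitz sums as counts of exponents. -/

/-- The exponent of `x` in the term of the sum `∑ v, ψ^m(v) ψ(v + 1)` with index `v`, where
`ψ(γ) = x`. -/
noncomputable def jacobiExponent (e : ℕ) (γ : Fˣ) (m : ℤ) (v : F) : ℕ :=
  ((discreteLog γ (v + 1) + m * discreteLog γ v : ℤ) : ZMod e).val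

variable (F) in
open Classical in
/-- The elements `v` of `F` with `v ≠ 0` and `v + 1 ≠ 0`. -/
noncomputable def jacobiSupport : Finset F := {v | v ≠ 0 ∧ v + 1 ≠ 0}

lemma mem_jacobiSupport {v : F} : v ∈ jacobiSupport F ↔ v ≠ 0 ∧ v + 1 ≠ 0 := by
  simp [jacobiSupport]

open Classical in
lemma cyclotomicNumber_eq_card {γ : Fˣ} (hγ : ∀ x : Fˣ, x ∈ Subgroup.zpowers γ) {e : ℕ}
    (he : e ∣ Fintype.card F - 1) (a b : ℤ) :
    cyclotomicNumber e γ a b =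
      ((jacobiSupport F).filter fun v ↦ (discreteLog γ v : ZMod e) = a ∧
        (discreteLog γ (v + 1) : ZMod e) = b).card := by
  rw [cyclotomicNumber, ← Set.ncard_coe_finset]
  congr 1
  ext v
  simp only [zpow_mul_add_iff hγ he, Set.mem_ofPred_eq, Finset.coe_filter, mem_jacobiSupport]
  tauto

open Classical in
lemma dicksonHurwitz_eq_card {γ : Fˣ} (hγ : ∀ x : Fˣ, x ∈ Subgroup.zpowers γ) {e : ℕ} [NeZero e]
    (he : e ∣ Fintype.card F - 1) {k : ℕ} (hk : k < e) (m : ℤ) :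
    dicksonHurwitz e γ k m =
      (((jacobiSupport F).filter fun v ↦ jacobiExponent e γ m v = k).card : ℤ) := by
  rw [dicksonHurwitz, Finset.card_eq_sum_card_fiberwise (t := Finset.range e)
    (f := fun v ↦ (discreteLog γ v : ZMod e).val)
    (fun v _ ↦ Finset.mem_coe.mpr (Finset.mem_range.mpr (ZMod.val_lt _))), Nat.cast_sum]
  refine Finset.sum_congr rfl fun h hh ↦ ?_
  rw [cyclotomicNumber_eq_card hγ he, Finset.filter_filter]
  congr 2
  refine Finset.filter_congr fun v _ ↦ ?_
  have val_iff (x : ZMod e) {j : ℕ} (hj : j < e) : x.val = j ↔ x = j := by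
    constructor
    · rintro rfl; simp
    · rintro rfl; exact ZMod.val_cast_of_lt hj
  rw [jacobiExponent, val_iff _ hk, val_iff _ (Finset.mem_range.mp hh)]
  push_cast
  constructor
  · rintro ⟨h1, h2⟩
    exact ⟨by rw [h1, h2]; ring, h1⟩
  · rintro ⟨h1, h2⟩
    exact ⟨h2, by rw [← h1, h2]; ring⟩

/-- B(k, m) counts the v with exponent k, so weighting by f(k) amounts to summing f over the
exponents. -/
lemma sum_dicksonHurwitz {γ : Fˣ} (hγ : ∀ x : Fˣ, x ∈ Subgroup.zpowers γ) {e : ℕ} [NeZero e]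
    (he : e ∣ Fintype.card F - 1) (m : ℤ) (f : ℕ → ℤ) :
    ∑ k ∈ Finset.range e, f k * dicksonHurwitz e γ k m =
      ∑ v ∈ jacobiSupport F, f (jacobiExponent e γ m v) := by
  classical
  rw [← Finset.sum_fiberwise_of_maps_to (s := jacobiSupport F) (t := Finset.range e)
    (g := jacobiExponent e γ m) (fun v _ ↦ Finset.mem_range.mpr (ZMod.val_lt _))]
  refine Finset.sum_congr rfl fun k hk ↦ ?_
  rw [dicksonHurwitz_eq_card hγ he (Finset.mem_range.mp hk),
    Finset.sum_congr rfl (g := fun _ ↦ f k)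
    (fun s hs ↦ by rw [(Finset.mem_filter.mp hs).2]), Finset.sum_const, nsmul_eq_mul, mul_comm]

/-- The logarithms of the units run through 0, …, q - 2, which covers each residue mod l exactly (q
- 1)/l times, a multiple of l because l² divides q - 1. The element 0 contributes f(0) by the
default value of `discreteLog`. -/
lemma sum_discreteLog {γ : Fˣ} (hγ : ∀ x : Fˣ, x ∈ Subgroup.zpowers γ) {l : ℕ}
    (hl : l ^ 2 ∣ Fintype.card F - 1) (f : ZMod l → ZMod l) (hf : f 0 = 0) :
    ∑ v : F, f (discreteLog γ v) = 0 := by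
  classical
  have hl1 : l ∣ Fintype.card F - 1 := (Dvd.intro _ (sq l).symm).trans hl
  have h1 : ∑ v : F, f (discreteLog γ v) = ∑ x : Fˣ, f (discreteLog γ (x : F)) := by
    rw [← Finset.sum_subset (Finset.subset_univ (Finset.univ.map
      ⟨((↑) : Fˣ → F), Units.val_injective⟩))]
    · rw [Finset.sum_map]; rfl
    · intro v _ hv
      have : v = 0 := by
        by_contra h
        exact hv (Finset.mem_map.mpr ⟨Units.mk0 v h, Finset.mem_univ _, rfl⟩)
      simp [this, discreteLog_zero, hf]
  have h2 : ∑ x : Fˣ, f (discreteLog γ (x : F)) =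
      ∑ k ∈ Finset.range (orderOf γ), f (discreteLog γ ((γ ^ (k : ℤ) : Fˣ) : F)) := by
    rw [← IsCyclic.image_range_orderOf hγ, Finset.sum_image]
    · simp
    · intro i hi j hj hij
      exact pow_injOn_Iio_orderOf (by simpa using hi) (by simpa using hj) hij
  obtain ⟨c, hc⟩ := hl
  rw [h1, h2, orderOf_eq_card_of_forall_mem_zpowers hγ, Nat.card_eq_fintype_card,
    Fintype.card_units, hc, sq, mul_assoc, sum_range_mul_eq]
  simp only [discreteLog_zpow hγ hl1]
  simp

lemma sum_discreteLog_succ {γ : Fˣ} (hγ : ∀ x : Fˣ, x ∈ Subgroup.zpowers γ) {l : ℕ}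
    (hl : l ^ 2 ∣ Fintype.card F - 1) (f : ZMod l → ZMod l) (hf : f 0 = 0) :
    ∑ v : F, f (discreteLog γ (v + 1)) = 0 :=
  (Equiv.sum_comp (Equiv.addRight (1 : F)) fun v ↦ f (discreteLog γ v)).trans
    (sum_discreteLog hγ hl f hf)

end DiscreteLog

/-! ### Arithmetic modulo l and truncated binomial expansion. -/

lemma dvd_of_sq_dvd {l n : ℕ} (h : l ^ 2 ∣ n) : l ∣ n := (Dvd.intro _ (sq l).symm).trans h

lemma two_ne_zero_zmod {l : ℕ} (hl3 : 3 ≤ l) : (2 : ZMod l) ≠ 0 := by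
  intro h
  have := (ZMod.natCast_eq_zero_iff 2 l).mp (by exact_mod_cast h)
  exact absurd (Nat.le_of_dvd two_pos this) (by omega)

/-- Lucas' theorem; it explains why c_{l,m} is weighted by t, the quotient of lt + j by l. -/
lemma choose_prime_modEq_div {l : ℕ} [Fact l.Prime] (k : ℕ) :
    (k.choose l : ZMod l) = ((k / l : ℕ) : ZMod l) := by
  have hl : 0 < l := (Fact.out : l.Prime).pos
  rw [ZMod.natCast_eq_natCast_iff]
  simpa [Nat.div_self hl] using Choose.choose_modEq_choose_mod_mul_choose_div_nat (n := k) (k := l)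
    (p := l)

lemma pow_eq_sum_choose {S : Type*} [CommRing S] {l : ℕ} {x : S}
    (hx : (x - 1) ^ (l + 1) = 0) (k : ℕ) :
    x ^ k = ∑ i ∈ Finset.range (l + 1), (k.choose i : S) * (x - 1) ^ i := by
  have h : x ^ k = ∑ i ∈ Finset.range (k + 1), (k.choose i : S) * (x - 1) ^ i := by
    conv_lhs => rw [← sub_add_cancel x 1, add_pow]
    refine Finset.sum_congr rfl fun i _ ↦ ?_
    rw [one_pow, mul_one, mul_comm]
  have h1 : ∑ i ∈ Finset.range (k + 1), (k.choose i : S) * (x - 1) ^ i =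
      ∑ i ∈ Finset.range (k + 1 + (l + 1)), (k.choose i : S) * (x - 1) ^ i := by
    refine Finset.sum_subset (Finset.range_mono (by omega)) fun i _ hi ↦ ?_
    rw [Nat.choose_eq_zero_of_lt (by simpa using hi), Nat.cast_zero, zero_mul]
  have h2 : ∑ i ∈ Finset.range (l + 1), (k.choose i : S) * (x - 1) ^ i =
      ∑ i ∈ Finset.range (k + 1 + (l + 1)), (k.choose i : S) * (x - 1) ^ i := by
    refine Finset.sum_subset (Finset.range_mono (by omega)) fun i _ hi ↦ ?_
    rw [pow_eq_zero_of_le (by simpa using hi) hx, mul_zero]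
  rw [h, h1, h2]

lemma natCast_jacobiExponent {F : Type*} [Field F] {l e : ℕ} [NeZero e] (hle : l ∣ e) (γ : Fˣ)
    (m : ℤ) (v : F) :
    (jacobiExponent e γ m v : ZMod l) = discreteLog γ (v + 1) + m * discreteLog γ v := by
  have h := ZMod.val_intCast (n := e) (discreteLog γ (v + 1) + m * discreteLog γ v)
  rw [jacobiExponent, ← Int.cast_natCast (R := ZMod l), h, ← Int.cast_mul, ← Int.cast_add,
    ZMod.intCast_eq_intCast_iff]
  exact (Int.mod_modEq _ _).of_dvd (by exact_mod_cast hle)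

/-! ### Expansion coefficients modulo l. -/

section Expansion

variable {F : Type*} [Field F] [Fintype F]

lemma card_jacobiSupport {l : ℕ} (hq : l ^ 2 ∣ Fintype.card F - 1) :
    ((jacobiSupport F).card : ZMod l) = -1 := by
  classical
  have h : jacobiSupport F = (Finset.univ.erase 0).erase (-1) := by
    ext v
    simp [mem_jacobiSupport, add_eq_zero_iff_eq_neg, and_comm]
  rw [h, Finset.card_erase_of_mem (by simp), Finset.card_erase_of_mem (by simp),
    Finset.card_univ]
  have h1 := (ZMod.natCast_eq_zero_iff _ l).mpr (dvd_of_sq_dvd hq)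
  have h2 := Fintype.one_lt_card (α := F)
  rw [Nat.cast_sub (by omega), h1]
  simp

variable {l : ℕ} [Fact l.Prime] (hl3 : 3 ≤ l) {γ : Fˣ} (hγ : ∀ x : Fˣ, x ∈ Subgroup.zpowers γ)
  (hq : l ^ 2 ∣ Fintype.card F - 1)

include hl3 hγ hq

lemma discreteLog_neg_one : (discreteLog γ (-1 : F) : ZMod l) = 0 := by
  have h := discreteLog_inv hγ (dvd_of_sq_dvd hq) (-1)
  rw [inv_neg_one, eq_neg_iff_add_eq_zero, ← two_mul] at h
  exact (mul_eq_zero.mp h).resolve_left (two_ne_zero_zmod hl3)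

/-- The added terms v = 0 and v = -1 are f(0): the logarithms of 1 and -1 vanish mod l, and that of
0 is 0 by convention. -/
lemma sum_jacobiSupport_eq_sum (m : ℤ) (f : ZMod l → ZMod l) (hf : f 0 = 0) :
    ∑ v ∈ jacobiSupport F, f (jacobiExponent (l ^ 2) γ m v) =
      ∑ v : F, f (discreteLog γ (v + 1) + m * discreteLog γ v) := by
  have hl1 := dvd_of_sq_dvd hq
  have : NeZero l := ⟨by omega⟩
  simp_rw [natCast_jacobiExponent (e := l ^ 2) (Dvd.intro _ (sq l).symm) γ m]
  refine Finset.sum_subset (Finset.subset_univ _) fun v _ hv ↦ ?_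
  rw [mem_jacobiSupport, not_and_or, not_not, not_not] at hv
  rcases hv with rfl | hv
  · simp [discreteLog_zero, discreteLog_one hγ hl1, hf]
  · rw [hv, eq_neg_of_add_eq_zero_left hv, discreteLog_neg_one hl3 hγ hq, discreteLog_zero]
    simp [hf]

/-- The substitution v ↦ v⁻¹ sends the sum S to -S plus a sum of squared logarithms, which is 0.
Hence 2S = 0 with l odd. -/
lemma sum_discreteLog_mul_succ :
    ∑ v : F, (discreteLog γ v : ZMod l) * discreteLog γ (v + 1) = 0 := by
  have hl1 := dvd_of_sq_dvd hq
  set S := ∑ v : F, (discreteLog γ v : ZMod l) * discreteLog γ (v + 1) with hS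
  have h : S = -S + ∑ v : F, (discreteLog γ v : ZMod l) ^ 2 := by
    conv_lhs => rw [hS, ← Equiv.sum_comp (inv_involutive (G := F)).toPerm]
    rw [hS, ← Finset.sum_neg_distrib, ← Finset.sum_add_distrib]
    refine Finset.sum_congr rfl fun v _ ↦ ?_
    rw [Function.Involutive.coe_toPerm]
    rcases eq_or_ne v 0 with rfl | hv
    · simp [discreteLog_zero]
    rcases eq_or_ne (v + 1) 0 with hv1 | hv1
    · rw [eq_neg_of_add_eq_zero_left hv1, inv_neg_one, discreteLog_neg_one hl3 hγ hq]
      simp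
    · have h : v⁻¹ + 1 = v⁻¹ * (v + 1) := by field_simp; ring
      rw [h, discreteLog_mul hγ hl1 (inv_ne_zero hv) hv1, discreteLog_inv hγ hl1]
      ring
  rw [sum_discreteLog hγ hq (fun x ↦ x ^ 2) (by simp), add_zero, eq_neg_iff_add_eq_zero,
    ← two_mul] at h
  exact (mul_eq_zero.mp h).resolve_left (two_ne_zero_zmod hl3)

lemma sum_jacobiExponent (m : ℤ) :
    ∑ v ∈ jacobiSupport F, (jacobiExponent (l ^ 2) γ m v : ZMod l) = 0 := by
  rw [sum_jacobiSupport_eq_sum hl3 hγ hq m (fun x ↦ x) rfl, Finset.sum_add_distrib,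
    ← Finset.mul_sum, sum_discreteLog_succ hγ hq (fun x ↦ x) rfl,
    sum_discreteLog hγ hq (fun x ↦ x) rfl]
  simp

lemma sum_jacobiExponent_sq (m : ℤ) :
    ∑ v ∈ jacobiSupport F, (jacobiExponent (l ^ 2) γ m v : ZMod l) ^ 2 = 0 := by
  rw [sum_jacobiSupport_eq_sum hl3 hγ hq m (fun x ↦ x ^ 2) (by simp)]
  have h (v : F) : ((discreteLog γ (v + 1) : ZMod l) + m * discreteLog γ v) ^ 2 =
      (discreteLog γ (v + 1) : ZMod l) ^ 2 +
        2 * m * ((discreteLog γ v : ZMod l) * discreteLog γ (v + 1)) +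
        (m : ZMod l) ^ 2 * (discreteLog γ v : ZMod l) ^ 2 := by ring
  simp_rw [h, Finset.sum_add_distrib, ← Finset.mul_sum]
  rw [sum_discreteLog_succ hγ hq (fun x ↦ x ^ 2) (by simp),
    sum_discreteLog hγ hq (fun x ↦ x ^ 2) (by simp), sum_discreteLog_mul_succ hl3 hγ hq]
  simp

lemma sum_jacobiExponent_choose_two (m : ℤ) :
    ∑ v ∈ jacobiSupport F, ((jacobiExponent (l ^ 2) γ m v).choose 2 : ZMod l) = 0 := by
  have h (k : ℕ) : (2 : ZMod l) * (k.choose 2 : ZMod l) = (k : ZMod l) ^ 2 - k := by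
    induction k with
    | zero => simp
    | succ k ih =>
      rw [Nat.choose_succ_succ, Nat.choose_one_right]
      push_cast
      linear_combination ih
  refine (mul_eq_zero.mp ?_).resolve_left (two_ne_zero_zmod hl3)
  simp_rw [Finset.mul_sum, h, Finset.sum_sub_distrib]
  rw [sum_jacobiExponent hl3 hγ hq, sum_jacobiExponent_sq hl3 hγ hq, sub_zero]

/-- Modulo `l`, the coefficients `c_{i,m}` with `i ≤ l` are sums of binomial coefficients of
exponents. -/
lemma jacobiCoeff_eq_sum_choose (i : ℕ) (m : ℤ) :
    (jacobiCoeff l γ i m : ZMod l) =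
      ∑ v ∈ jacobiSupport F, ((jacobiExponent (l ^ 2) γ m v).choose i : ZMod l) := by
  have : NeZero l := ⟨by omega⟩
  rw [jacobiCoeff]
  split_ifs with h
  · have h1 : ∑ t ∈ Finset.range l, ∑ j ∈ Finset.range l,
        (t : ℤ) * dicksonHurwitz (l ^ 2) γ ((l : ℤ) * (t : ℤ) + (j : ℤ)) m =
        ∑ k ∈ Finset.range (l ^ 2), ((k / l : ℕ) : ℤ) * dicksonHurwitz (l ^ 2) γ k m := by
      rw [sq, sum_range_mul_eq]
      refine Finset.sum_congr rfl fun t _ ↦ Finset.sum_congr rfl fun j hj ↦ ?_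
      rw [Nat.mul_add_div (by omega), Nat.div_eq_of_lt (Finset.mem_range.mp hj), add_zero]
      push_cast
      rfl
    rw [h1, sum_dicksonHurwitz hγ hq m (fun k ↦ ((k / l : ℕ) : ℤ)), h, Int.cast_sum]
    refine Finset.sum_congr rfl fun v _ ↦ ?_
    rw [choose_prime_modEq_div, Int.cast_natCast]
  · rw [sum_dicksonHurwitz hγ hq m (fun k ↦ (k.choose i : ℤ)), Int.cast_sum]
    simp

/-- The expansion of a Jacobi sum in powers of `x - 1`, in a ring of characteristic `l` in which
`(x - 1) ^ (l + 1)` vanishes. -/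
lemma sum_pow_jacobiExponent {S : Type*} [CommRing S] (hS : (l : S) = 0) {x : S}
    (hx : (x - 1) ^ (l + 1) = 0) (m : ℤ) :
    ∑ v ∈ jacobiSupport F, x ^ jacobiExponent (l ^ 2) γ m v =
      -1 + ∑ i ∈ Finset.Icc 3 l, (jacobiCoeff l γ i m : S) * (x - 1) ^ i := by
  -- As l = 0 in S, integer coefficients matter only mod l.
  have cast_eq {a b : ℤ} (h : (a : ZMod l) = b) : (a : S) = b := by
    rw [ZMod.intCast_eq_intCast_iff_dvd_sub] at h
    obtain ⟨c, hc⟩ := h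
    have := congrArg (Int.cast : ℤ → S) hc
    push_cast at this
    rw [hS, zero_mul, sub_eq_zero] at this
    exact this.symm
  let D (i : ℕ) : ℤ := ∑ v ∈ jacobiSupport F, ((jacobiExponent (l ^ 2) γ m v).choose i : ℤ)
  have hD : ∑ v ∈ jacobiSupport F, x ^ jacobiExponent (l ^ 2) γ m v =
      ∑ i ∈ Finset.range (l + 1), (D i : S) * (x - 1) ^ i := by
    simp_rw [pow_eq_sum_choose hx]
    rw [Finset.sum_comm]
    refine Finset.sum_congr rfl fun i _ ↦ ?_
    rw [← Finset.sum_mul]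
    simp [D]
  have h0 : (D 0 : S) = ((-1 : ℤ) : S) := cast_eq <| by
    simpa [D] using card_jacobiSupport hq
  have h1 : (D 1 : S) = ((0 : ℤ) : S) := cast_eq <| by
    simpa [D] using sum_jacobiExponent hl3 hγ hq m
  have h2 : (D 2 : S) = ((0 : ℤ) : S) := cast_eq <| by
    simpa [D] using sum_jacobiExponent_choose_two hl3 hγ hq m
  rw [hD, ← Finset.sum_range_add_sum_Ico _ (show 3 ≤ l + 1 by omega)]
  congr 1
  · simp [Finset.sum_range_succ, h0, h1, h2]
  · refine Finset.sum_congr (by ext; simp) fun i _ ↦ ?_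
    rw [cast_eq (a := D i) (b := jacobiCoeff l γ i m)]
    rw [jacobiCoeff_eq_sum_choose hl3 hγ hq]
    simp [D]

end Expansion

/-! ### Congruences in ℤ[ξ]. -/

section Congruence

variable {ξ m : ℂ}

lemma congrInAdjoin_iff_dvd {μ a b : Algebra.adjoin ℤ ({ξ} : Set ℂ)} :
    CongrInAdjoin ξ μ a b ↔ μ ∣ a - b := by
  constructor
  · rintro ⟨t, ht, h⟩
    exact ⟨⟨t, ht⟩, Subtype.ext h⟩
  · rintro ⟨t, h⟩
    exact ⟨t, t.2, congrArg Subtype.val h⟩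

lemma CongrInAdjoin.mul {a b c d : ℂ} (h₁ : CongrInAdjoin ξ m a b) (h₂ : CongrInAdjoin ξ m c d)
    (hb : b ∈ Algebra.adjoin ℤ ({ξ} : Set ℂ)) (hc : c ∈ Algebra.adjoin ℤ ({ξ} : Set ℂ)) :
    CongrInAdjoin ξ m (a * c) (b * d) := by
  obtain ⟨s, hs, h₁⟩ := h₁
  obtain ⟨t, ht, h₂⟩ := h₂
  exact ⟨s * c + b * t, add_mem (mul_mem hs hc) (mul_mem hb ht),
    by linear_combination c * h₁ + b * h₂⟩

lemma CongrInAdjoin.mul_left {a b c : ℂ} (h : CongrInAdjoin ξ m a b)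
    (hc : c ∈ Algebra.adjoin ℤ ({ξ} : Set ℂ)) : CongrInAdjoin ξ m (c * a) (c * b) := by
  obtain ⟨t, ht, h⟩ := h
  exact ⟨c * t, mul_mem hc ht, by linear_combination c * h⟩

lemma CongrInAdjoin.trans {a b c : ℂ} (h₁ : CongrInAdjoin ξ m a b) (h₂ : CongrInAdjoin ξ m b c) :
    CongrInAdjoin ξ m a c := by
  obtain ⟨s, hs, h₁⟩ := h₁
  obtain ⟨t, ht, h₂⟩ := h₂
  exact ⟨s + t, add_mem hs ht, by linear_combination h₁ + h₂⟩

lemma self_mem_adjoin : ξ ∈ Algebra.adjoin ℤ ({ξ} : Set ℂ) :=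
  Algebra.subset_adjoin (Set.mem_singleton ξ)

lemma zpow_eq_pow_val {e : ℕ} [NeZero e] {x : ℂ} (hx : x ^ e = 1) (k : ℤ) :
    x ^ k = x ^ (k : ZMod e).val := by
  have hx0 : x ≠ 0 := by
    rintro rfl
    simp [zero_pow (NeZero.ne e)] at hx
  rw [← zpow_natCast x (ZMod.val _), ZMod.val_intCast]
  conv_lhs => rw [← Int.mul_ediv_add_emod k e, zpow_add₀ hx0, zpow_mul, zpow_natCast, hx,
    one_zpow, one_mul]

lemma zpow_mem_adjoin {e : ℕ} [NeZero e] (hξ : ξ ^ e = 1) (k : ℤ) :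
    ξ ^ k ∈ Algebra.adjoin ℤ ({ξ} : Set ℂ) := by
  rw [zpow_eq_pow_val hξ]
  exact pow_mem self_mem_adjoin _

/-- In `ℤ[ξ]` with `ξ` of order `l ^ 2`, the prime `l` is divisible by `(1 - ξ) ^ (l + 1)`. -/
lemma one_sub_pow_dvd_prime {l : ℕ} (hl : l.Prime) (hl3 : 3 ≤ l) (hξ : IsPrimitiveRoot ξ (l ^ 2)) :
    (1 - ⟨ξ, self_mem_adjoin⟩) ^ (l + 1) ∣ (l : Algebra.adjoin ℤ ({ξ} : Set ℂ)) := by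
  have : Fact l.Prime := ⟨hl⟩
  have : NeZero l := ⟨hl.ne_zero⟩
  set x : Algebra.adjoin ℤ ({ξ} : Set ℂ) := ⟨ξ, self_mem_adjoin⟩ with hx
  have hxp : IsPrimitiveRoot x (l ^ 2) :=
    IsPrimitiveRoot.of_map_of_injective (f := (Algebra.adjoin ℤ ({ξ} : Set ℂ)).val) hξ
      Subtype.val_injective
  -- l is the value at 1 of the `l²`-th cyclotomic polynomial; each factor 1 - μ, with μ a power of
  -- x, is a multiple of 1 - x.
  have h1 : (l : Algebra.adjoin ℤ ({ξ} : Set ℂ)) =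
      ∏ μ ∈ primitiveRoots (l ^ 2) (Algebra.adjoin ℤ ({ξ} : Set ℂ)), (1 - μ) := by
    rw [← Polynomial.eval_one_cyclotomic_prime_pow (R := Algebra.adjoin ℤ ({ξ} : Set ℂ)) (p := l) 1,
      Polynomial.cyclotomic_eq_prod_X_sub_primitiveRoots hxp, Polynomial.eval_prod]
    simp
  have h2 : (1 - x) ^ (primitiveRoots (l ^ 2) (Algebra.adjoin ℤ ({ξ} : Set ℂ))).card ∣
      ∏ μ ∈ primitiveRoots (l ^ 2) (Algebra.adjoin ℤ ({ξ} : Set ℂ)), (1 - μ) := by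
    rw [← Finset.prod_const]
    refine Finset.prod_dvd_prod_of_dvd _ _ fun μ hμ ↦ ?_
    obtain ⟨i, -, rfl⟩ := hxp.eq_pow_of_pow_eq_one
      (isPrimitiveRoot_of_mem_primitiveRoots hμ).pow_eq_one
    simpa using sub_dvd_pow_sub_pow 1 x i
  rw [h1]
  -- There are l(l - 1) factors, at least l + 1 since l ≥ 3.
  refine (pow_dvd_pow _ ?_).trans h2
  rw [hxp.card_primitiveRoots, Nat.totient_prime_pow hl two_pos]
  obtain ⟨k, rfl⟩ := Nat.exists_eq_add_of_le hl3
  simp only [show 2 - 1 = 1 from rfl, pow_one, show 3 + k - 1 = 2 + k by omega]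
  nlinarith

end Congruence

/-! ### Jacobi sums of order dividing l² and the factors C_m. -/

section Factor

variable {F : Type*} [Field F]

lemma jacobiFactor_coe (l : ℕ) (γ : Fˣ) (m : ℤ) (A : Subalgebra ℤ ℂ) (x : A) :
    ((-1 + ∑ i ∈ Finset.Icc 3 l, (jacobiCoeff l γ i m : A) * (x - 1) ^ i : A) : ℂ) =
      jacobiFactor l γ m x := by
  simp [jacobiFactor]

lemma jacobiFactor_mem (l : ℕ) (γ : Fˣ) (m : ℤ) {A : Subalgebra ℤ ℂ} {x : ℂ} (hx : x ∈ A) :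
    jacobiFactor l γ m x ∈ A := by
  rw [← jacobiFactor_coe l γ m A ⟨x, hx⟩]
  exact Subtype.prop _

/-- The factor `C_m` is `-1` at roots of unity of order `l`. -/
lemma jacobiFactor_congr_neg_one {l : ℕ} (hl : l.Prime) (hl3 : 3 ≤ l) {ξ : ℂ}
    (hξ : IsPrimitiveRoot ξ (l ^ 2)) (γ : Fˣ) (m : ℤ) (d : ℕ) :
    CongrInAdjoin ξ ((1 - ξ) ^ (l + 1)) (jacobiFactor l γ m (ξ ^ (l * d))) (-1) := by
  have hdvd := one_sub_pow_dvd_prime hl hl3 hξ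
  set x : Algebra.adjoin ℤ ({ξ} : Set ℂ) := ⟨ξ, self_mem_adjoin⟩ with hx
  have h1 : (1 - x) ^ l ∣ x ^ (l * d) - 1 := by
    have h2 : x ^ l - 1 ∣ x ^ (l * d) - 1 := by
      simpa [pow_mul] using sub_dvd_pow_sub_pow (x ^ l) 1 d
    refine Dvd.dvd.trans ?_ h2
    obtain ⟨r, hr⟩ := exists_add_pow_prime_eq hl (x - 1) 1
    rw [sub_add_cancel, one_pow] at hr
    have h3 : x ^ l - 1 = (x - 1) ^ l + l * ((x - 1) * 1 * r) := by
      rw [hr]; ring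
    rw [h3]
    refine dvd_add (pow_dvd_pow_of_dvd ⟨-1, by ring⟩ l) (Dvd.dvd.mul_right ?_ _)
    exact (pow_dvd_pow _ (Nat.le_succ l)).trans hdvd
  have h4 := (congrInAdjoin_iff_dvd (ξ := ξ) (μ := (1 - x) ^ (l + 1))
    (a := -1 + ∑ i ∈ Finset.Icc 3 l, (jacobiCoeff l γ i m : Algebra.adjoin ℤ ({ξ} : Set ℂ)) *
      (x ^ (l * d) - 1) ^ i) (b := -1)).mpr ?_
  · rw [jacobiFactor_coe] at h4
    simpa [hx] using h4
  -- All terms have i ≥ 3, so they are divisible by (1 - x)^(3l), and 3l ≥ l + 1.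
  · rw [add_sub_cancel_left]
    refine Finset.dvd_sum fun i hi ↦ Dvd.dvd.mul_left ?_ _
    refine Dvd.dvd.trans ?_ (pow_dvd_pow_of_dvd h1 i)
    rw [← pow_mul]
    refine pow_dvd_pow _ ?_
    have := (Finset.mem_Icc.mp hi).1
    nlinarith

lemma mulChar_zpow (ψ : MulChar F ℂ) (γ : Fˣ) (k : ℤ) : ψ ((γ ^ k : Fˣ) : F) = ψ γ ^ k := by
  rw [← MulChar.coe_toUnitHom, map_zpow, Units.val_zpow_eq_zpow_val, MulChar.coe_toUnitHom]

variable [Fintype F]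

lemma shiftedJacobiSum_eq_sum_pow {γ : Fˣ} (hγ : ∀ x : Fˣ, x ∈ Subgroup.zpowers γ) {e : ℕ}
    [NeZero e] {ψ : MulChar F ℂ} (hψ : ψ γ ^ e = 1) (m : ℤ) :
    shiftedJacobiSum (ψ ^ m) ψ = ∑ v ∈ jacobiSupport F, ψ γ ^ jacobiExponent e γ m v := by
  classical
  rw [shiftedJacobiSum]
  symm
  refine Finset.sum_subset_zero_on_sdiff (Finset.subset_univ _) (fun v hv ↦ ?_) fun v hv ↦ ?_
  · have hv' := (Finset.mem_sdiff.mp hv).2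
    rw [mem_jacobiSupport, not_and_or, not_not, not_not] at hv'
    rcases hv' with rfl | hv'
    · rw [MulChar.map_zero, zero_mul]
    · rw [hv', MulChar.map_zero, mul_zero]
  · rw [mem_jacobiSupport] at hv
    have hγ0 : ψ γ ≠ 0 := (γ.isUnit.map ψ).ne_zero
    have h1 : (ψ ^ m) v = ψ γ ^ (m * discreteLog γ v) := by
      conv_lhs => rw [← zpow_discreteLog hγ hv.1, MulChar.zpow_apply_coe, ← zpow_mul,
        mulChar_zpow, mul_comm]
    have h2 : ψ (v + 1) = ψ γ ^ discreteLog γ (v + 1) := by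
      conv_lhs => rw [← zpow_discreteLog hγ hv.2, mulChar_zpow]
    rw [h1, h2, ← zpow_add₀ hγ0, add_comm, zpow_eq_pow_val hψ, jacobiExponent]

/-- The expansion of a Jacobi sum of characters of order dividing `l ^ 2` modulo
`(1 - ξ) ^ (l + 1)`. -/
lemma shiftedJacobiSum_congr_jacobiFactor {l : ℕ} (hl : l.Prime) (hl3 : 3 ≤ l)
    (hq : l ^ 2 ∣ Fintype.card F - 1) {γ : Fˣ} (hγ : ∀ x : Fˣ, x ∈ Subgroup.zpowers γ) {ξ : ℂ}
    (hξ : IsPrimitiveRoot ξ (l ^ 2)) {ψ : MulChar F ℂ} {k : ℤ} (hψ : ψ γ = ξ ^ k) (m : ℤ) :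
    CongrInAdjoin ξ ((1 - ξ) ^ (l + 1)) (shiftedJacobiSum (ψ ^ m) ψ)
      (jacobiFactor l γ m (ξ ^ k)) := by
  have : Fact l.Prime := ⟨hl⟩
  have : NeZero l := ⟨hl.ne_zero⟩
  have hdvd := one_sub_pow_dvd_prime hl hl3 hξ
  rw [shiftedJacobiSum_eq_sum_pow hγ (e := l ^ 2)
    (by rw [hψ, ← zpow_natCast, zpow_comm, zpow_natCast, hξ.pow_eq_one, one_zpow]), hψ,
    zpow_eq_pow_val hξ.pow_eq_one]
  generalize (k : ZMod (l ^ 2)).val = j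
  set A := Algebra.adjoin ℤ ({ξ} : Set ℂ) with hA
  set x : A := ⟨ξ, self_mem_adjoin⟩ with hx
  have h1 := (congrInAdjoin_iff_dvd (ξ := ξ) (μ := (1 - x) ^ (l + 1))
    (a := ∑ v ∈ jacobiSupport F, (x ^ j) ^ jacobiExponent (l ^ 2) γ m v)
    (b := -1 + ∑ i ∈ Finset.Icc 3 l, (jacobiCoeff l γ i m : A) * (x ^ j - 1) ^ i)).mpr ?_
  · rw [jacobiFactor_coe] at h1
    simpa [hx] using h1
  · rw [← Ideal.mem_span_singleton, ← Ideal.Quotient.eq, map_sum]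
    have h2 := sum_pow_jacobiExponent (S := A ⧸ Ideal.span {(1 - x) ^ (l + 1)}) hl3 hγ hq
      (x := Ideal.Quotient.mk _ (x ^ j)) ?_ ?_ m
    · simpa using h2
    · rw [← map_natCast (Ideal.Quotient.mk (Ideal.span {(1 - x) ^ (l + 1)})),
        Ideal.Quotient.eq_zero_iff_mem, Ideal.mem_span_singleton]
      exact hdvd
    · rw [← map_one (Ideal.Quotient.mk _), ← map_sub, ← map_pow,
        Ideal.Quotient.eq_zero_iff_mem, Ideal.mem_span_singleton]
      refine pow_dvd_pow_of_dvd ?_ _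
      rw [← neg_sub 1 (x ^ j), dvd_neg]
      simpa using sub_dvd_pow_sub_pow 1 x j

/-- With ψ = b², the power ψ^((l² - 1)/2) is b⁻¹, and J(b⁻¹, b²) = J(b², b⁻¹) = J(b⁻¹, b⁻¹) by
symmetry and inversion. This is the origin of the index (l² - 1)/2. -/
lemma shiftedJacobiSum_inv_congr_jacobiFactor {l : ℕ} (hl : l.Prime) (hl3 : 3 ≤ l)
    (hq : l ^ 2 ∣ Fintype.card F - 1) {γ : Fˣ} (hγ : ∀ x : Fˣ, x ∈ Subgroup.zpowers γ) {ξ : ℂ}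
    (hξ : IsPrimitiveRoot ξ (l ^ 2)) {b : MulChar F ℂ} (hb : b ^ (l ^ 2) = 1) {k : ℤ}
    (hbγ : (b ^ 2) γ = ξ ^ k) :
    CongrInAdjoin ξ ((1 - ξ) ^ (l + 1)) (shiftedJacobiSum b⁻¹ b⁻¹)
      (jacobiFactor l γ (((l : ℤ) ^ 2 - 1) / 2) (ξ ^ k)) := by
  have hodd : Odd (l ^ 2) := (hl.odd_of_ne_two (by omega)).pow
  have hb1 : b (-1) = 1 := MulChar.val_neg_one_eq_one_of_odd_order hodd hb
  have h := shiftedJacobiSum_congr_jacobiFactor hl hl3 hq hγ hξ hbγ (((l : ℤ) ^ 2 - 1) / 2)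
  have h2 : (b ^ 2) ^ (((l : ℤ) ^ 2 - 1) / 2) = b⁻¹ := by
    obtain ⟨c, hc⟩ := hodd
    have hc' : (l : ℤ) ^ 2 = 2 * c + 1 := by exact_mod_cast hc
    rw [hc', add_sub_cancel_right, Int.mul_ediv_cancel_left _ two_ne_zero, zpow_natCast,
      ← pow_mul, eq_inv_iff_mul_eq_one, ← pow_succ, ← hc, hb]
  have hb2 : (b ^ 2) (-1) = 1 := by rw [MulChar.pow_apply' _ two_ne_zero, hb1, one_pow]
  have hbi : b⁻¹ (-1) = 1 := by rw [MulChar.inv_apply_eq_inv', hb1, inv_one]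
  rwa [h2, shiftedJacobiSum_comm hbi hb2, shiftedJacobiSum_eq_inv_mul, sq, mul_inv_cancel_right]
    at h

end Factor

/-! ### Removing the factor q and the three cases. -/

section Main

variable {F : Type*} [Field F] [Fintype F]

lemma shiftedJacobiSum_mem {ζ : ℂ} {e : ℕ} [NeZero e] (hζ : IsPrimitiveRoot ζ e)
    {A : Subalgebra ℤ ℂ} (hA : ζ ∈ A) {a b : MulChar F ℂ} (ha : a ^ e = 1) (hb : b ^ e = 1) :
    shiftedJacobiSum a b ∈ A := by
  have h : Algebra.adjoin ℤ {ζ} ≤ A := Algebra.adjoin_le (Set.singleton_subset_iff.mpr hA)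
  exact sum_mem fun v _ ↦ mul_mem (h (MulChar.apply_mem_algebraAdjoin_of_pow_eq_one ha hζ _))
    (h (MulChar.apply_mem_algebraAdjoin_of_pow_eq_one hb hζ _))

/-- q - 1 is a multiple of l, hence of (1 - ξ)^(l+1), so q acts as 1. -/
lemma CongrInAdjoin.of_card_mul {l : ℕ} (hl : l.Prime) (hl3 : 3 ≤ l)
    (hq : l ^ 2 ∣ Fintype.card F - 1) {ξ : ℂ} (hξ : IsPrimitiveRoot ξ (l ^ 2)) {X Y : ℂ}
    (hX : X ∈ Algebra.adjoin ℤ ({ξ} : Set ℂ))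
    (h : CongrInAdjoin ξ ((1 - ξ) ^ (l + 1)) ((Fintype.card F : ℂ) * X) Y) :
    CongrInAdjoin ξ ((1 - ξ) ^ (l + 1)) X Y := by
  obtain ⟨t, ht⟩ := one_sub_pow_dvd_prime hl hl3 hξ
  obtain ⟨s, hs, h⟩ := h
  obtain ⟨c, hc⟩ := dvd_of_sq_dvd hq
  have ht' : (l : ℂ) = (1 - ξ) ^ (l + 1) * t := by
    simpa using congrArg Subtype.val ht
  have hc' : (Fintype.card F : ℂ) = l * c + 1 := by
    have : Fintype.card F = l * c + 1 := by
      have := Fintype.card_pos (α := F)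
      omega
    exact_mod_cast this
  refine ⟨s - t * c * X, sub_mem hs (mul_mem (mul_mem t.2 (natCast_mem _ c)) hX), ?_⟩
  rw [hc', ht'] at h
  linear_combination h

end Main

theorem theorem3 {F : Type*} [Field F] [Fintype F] (l : ℕ) (hl : l.Prime) (hl3 : 3 ≤ l)
    (hq : Fintype.card F ≡ 1 [MOD 2 * l ^ 2])
    (γ : Fˣ) (hγ : ∀ x : Fˣ, x ∈ Subgroup.zpowers γ)
    (ζ : ℂ) (hζ : IsPrimitiveRoot ζ (2 * l ^ 2))
    (χ : MulChar F ℂ) (hχ : χ (γ : F) = ζ)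
    (ξ : ℂ) (hξ : ξ = ζ ^ 2)
    (w : ℤ) (hw : ((γ ^ w : Fˣ) : F) = 2)
    (n : ℕ) (hn1 : 1 ≤ n) (hn2 : n ≤ 2 * l ^ 2 - 3) (hnodd : Odd n) :
    (n = l ^ 2 →
      CongrInAdjoin ξ ((1 - ξ) ^ (l + 1)) (jacobiSumPlus χ 1 n)
        (ξ ^ (-w) * jacobiFactor l γ (((l : ℤ) ^ 2 - 1) / 2) ξ)) ∧
    (∀ d : ℕ, Odd d → d ≠ l → n = d * l →
      CongrInAdjoin ξ ((1 - ξ) ^ (l + 1)) (jacobiSumPlus χ 1 n)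
        (-ξ ^ (-w * ((d : ℤ) * l + 1)) *
          jacobiFactor l γ (((l : ℤ) ^ 2 - 1) / 2) ξ *
          jacobiFactor l γ ((d : ℤ) * l - 1) (ξ ^ ((-1 - (d : ℤ) * l) / 2)))) ∧
    (Nat.gcd n (2 * l ^ 2) = 1 →
      CongrInAdjoin ξ ((1 - ξ) ^ (l + 1)) (jacobiSumPlus χ 1 n)
        (ξ ^ (-w * ((n : ℤ) + 1)) *
          jacobiFactor l γ (((l : ℤ) ^ 2 - 1) / 2) ξ *
          jacobiFactor l γ (((l : ℤ) ^ 2 - 1) / 2) (ξ ^ n) *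
          jacobiFactor l γ (n : ℤ) (ξ ^ ((1 - (l : ℤ) ^ 2) / 2)))) := by
  have : NeZero l := ⟨hl.ne_zero⟩
  have hl9 : 9 ≤ l ^ 2 := by nlinarith
  have hlodd : Odd (l ^ 2) := (hl.odd_of_ne_two (by omega)).pow
  have hdvd : 2 * l ^ 2 ∣ Fintype.card F - 1 :=
    (Nat.modEq_iff_dvd' Fintype.card_pos).mp hq.symm
  have hq2 : l ^ 2 ∣ Fintype.card F - 1 := (Dvd.intro_left 2 rfl).trans hdvd
  have hF : ringChar F ≠ 2 := by
    intro h
    have h0 : (2 : F) = 0 := by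
      have := ringChar.Nat.cast_ringChar (R := F)
      rw [h] at this
      exact_mod_cast this
    exact Units.ne_zero _ (hw.trans h0)
  have hξp : IsPrimitiveRoot ξ (l ^ 2) := by
    rw [hξ]
    exact hζ.pow (by positivity) rfl
  have hξ0 : ξ ≠ 0 := hξp.ne_zero (by positivity)
  have hζl : ζ ^ l ^ 2 = -1 := by
    have h : (ζ ^ l ^ 2) ^ 2 = 1 := by rw [← pow_mul, mul_comm, hζ.pow_eq_one]
    refine (sq_eq_one_iff.mp h).resolve_left ?_
    exact hζ.pow_ne_one_of_pos_of_lt (by positivity) (by omega)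
  obtain ⟨c, hc⟩ := hlodd
  have hcz : (l : ℤ) ^ 2 = 2 * c + 1 := by exact_mod_cast hc
  -- the decomposition of `χ` into its quadratic part and its part of order `l ^ 2`
  set η := complexQuadraticChar F with hη
  set φ := χ ^ (l ^ 2 + 1) with hφ
  have hχη : χ ^ l ^ 2 = η :=
    eq_complexQuadraticChar hF hγ (by rw [MulChar.pow_apply_coe, hχ, hζl])
  have hχ1 : χ ^ (2 * l ^ 2) = 1 := by
    rw [MulChar.eq_iff hγ, MulChar.pow_apply_coe, hχ, hζ.pow_eq_one, MulChar.one_apply_coe]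
  have hφ1 : φ ^ l ^ 2 = 1 := by
    rw [hφ, ← pow_mul, show (l ^ 2 + 1) * l ^ 2 = 2 * l ^ 2 * (c + 1) by rw [hc]; ring, pow_mul,
      hχ1, one_pow]
  have hχφ : χ = η * φ := by
    rw [← hχη, hφ, ← pow_add, show l ^ 2 + (l ^ 2 + 1) = 2 * l ^ 2 + 1 by ring, pow_succ, hχ1,
      one_mul]
  -- Here c + 1 = (l² + 1)/2 is the inverse of 2 mod l², so φ(γ) is a square root of ξ in ℤ[ξ].
  have hφγ : φ γ = ξ ^ (c + 1) := by
    rw [hφ, MulChar.pow_apply_coe, hχ, hξ, ← pow_mul, hc]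
    ring
  have hφγ2 : (φ γ) ^ 2 = ξ := by
    rw [hφγ, ← pow_mul, show (c + 1) * 2 = l ^ 2 + 1 by omega, pow_succ, hξp.pow_eq_one, one_mul]
  have hφ2 : (φ ^ 2) γ = ξ ^ (1 : ℤ) := by rw [MulChar.pow_apply_coe, hφγ2, zpow_one]
  have hφ4 : φ 4 = ξ ^ w := by
    rw [show (4 : F) = 2 * 2 by norm_num, map_mul, ← hw, mulChar_zpow, ← mul_zpow, ← sq, hφγ2]
  have hφdvd {j : ℕ} (h : φ ^ j = 1) : l ^ 2 ∣ j := by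
    refine (hξp.pow_eq_one_iff_dvd j).mp ?_
    rw [← hφγ2, pow_right_comm, ← MulChar.pow_apply_coe, h, MulChar.one_apply_coe, one_pow]
  have hφne : φ ≠ 1 := fun h ↦ by
    have := Nat.le_of_dvd one_pos (hφdvd ((pow_one φ).trans h))
    omega
  have hneg : φ (-1) = 1 := MulChar.val_neg_one_eq_one_of_odd_order ⟨c, hc⟩ hφ1
  have hnegz (j : ℤ) : (φ ^ j) (-1) = 1 := by
    refine MulChar.val_neg_one_eq_one_of_odd_order (n := l ^ 2) ⟨c, hc⟩ ?_
    rw [← zpow_natCast, zpow_comm, zpow_natCast, hφ1, one_zpow]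
  have hJ : jacobiSumPlus χ 1 n = shiftedJacobiSum χ (χ ^ n) := by
    rw [jacobiSumPlus, shiftedJacobiSum, pow_one]
  -- membership in `ℤ[ξ]`
  have hζmem : ζ ∈ Algebra.adjoin ℤ ({ξ} : Set ℂ) := by
    have h : ζ = -ξ ^ (c + 1) := by
      rw [hξ, ← pow_mul, show 2 * (c + 1) = l ^ 2 + 1 by omega, pow_succ, hζl]
      ring
    rw [h]
    exact neg_mem (pow_mem self_mem_adjoin _)
  have hmem {a b : MulChar F ℂ} (ha : a ^ (2 * l ^ 2) = 1) (hb : b ^ (2 * l ^ 2) = 1) :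
      shiftedJacobiSum a b ∈ Algebra.adjoin ℤ ({ξ} : Set ℂ) :=
    shiftedJacobiSum_mem hζ hζmem ha hb
  have hφz (j : ℤ) : (φ ^ j) ^ (2 * l ^ 2) = 1 := by
    rw [← zpow_natCast, zpow_comm, zpow_natCast, mul_comm, pow_mul, hφ1, one_pow, one_zpow]
  have hξmem (j : ℤ) : ξ ^ j ∈ Algebra.adjoin ℤ ({ξ} : Set ℂ) := zpow_mem_adjoin hξp.pow_eq_one j
  -- the Jacobi sums of order `l ^ 2`
  have hC1 := shiftedJacobiSum_inv_congr_jacobiFactor hl hl3 hq2 hγ hξp hφ1 hφ2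
  rw [zpow_one] at hC1
  have hCn : CongrInAdjoin ξ ((1 - ξ) ^ (l + 1)) (shiftedJacobiSum (φ ^ n)⁻¹ (φ ^ n)⁻¹)
      (jacobiFactor l γ (((l : ℤ) ^ 2 - 1) / 2) (ξ ^ n)) := by
    have h := shiftedJacobiSum_inv_congr_jacobiFactor hl hl3 hq2 hγ hξp (b := φ ^ n) (k := n)
      (by rw [pow_right_comm, hφ1, one_pow])
      (by rw [← pow_mul, mul_comm, pow_mul, MulChar.pow_apply_coe, hφ2, zpow_one, zpow_natCast])
    rwa [zpow_natCast] at h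
  -- the reduction of the general case to characters of order `l ^ 2`
  have hred (hln : ¬ l ^ 2 ∣ n) :
      (Fintype.card F : ℂ) * jacobiSumPlus χ 1 n = ξ ^ (-w * ((n : ℤ) + 1)) *
        (shiftedJacobiSum φ (φ ^ n) * shiftedJacobiSum φ⁻¹ φ⁻¹ *
          shiftedJacobiSum (φ ^ n)⁻¹ (φ ^ n)⁻¹) := by
    have hcop : Nat.Coprime (l ^ 2) 2 := Nat.coprime_two_right.mpr ⟨c, hc⟩
    have h := card_mul_shiftedJacobiSum_twist hF (a := φ) (b := φ ^ n)
      (fun h ↦ by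
        have := Nat.le_of_dvd two_pos (hφdvd ((sq φ).trans h))
        omega)
      (fun h ↦ hln (hcop.dvd_of_dvd_mul_left (hφdvd (j := 2 * n) (by rw [two_mul, pow_add, h]))))
      -- φ^(n+1) = 1 would make n + 1 a multiple of l²; but n + 1 is positive, even and below 2l²,
      -- while l² is odd.
      (fun h ↦ by
        obtain ⟨k, hk⟩ := hφdvd ((pow_succ' φ n).trans h)
        obtain ⟨r, hr⟩ := hnodd
        have hk2 : k < 2 := by
          by_contra! hk2
          have := Nat.mul_le_mul_left (l ^ 2) hk2
          omega
        interval_cases k <;> omega)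
      hneg (by simpa using hnegz n)
    have hχn : χ ^ n = η * φ ^ n := by
      rw [hχφ, mul_pow, complexQuadraticChar_isQuadratic.pow_odd hnodd]
    rw [hJ, hχn, hχφ, h]
    congr 1
    have h4n : (φ ^ n) 4 = ξ ^ (w * n) := by
      rw [MulChar.pow_apply' _ (by omega), hφ4, ← zpow_natCast, zpow_mul]
    rw [hφ4, h4n, ← zpow_add₀ hξ0, ← zpow_neg]
    congr 1
    ring
  have hXmem : jacobiSumPlus χ 1 n ∈ Algebra.adjoin ℤ ({ξ} : Set ℂ) := by
    rw [hJ]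
    exact hmem hχ1 (by rw [pow_right_comm, hχ1, one_pow])
  have hP1 : shiftedJacobiSum φ⁻¹ φ⁻¹ ∈ Algebra.adjoin ℤ ({ξ} : Set ℂ) := by
    simpa using hmem (hφz (-1)) (hφz (-1))
  have hPn : shiftedJacobiSum (φ ^ n)⁻¹ (φ ^ n)⁻¹ ∈ Algebra.adjoin ℤ ({ξ} : Set ℂ) := by
    simpa using hmem (hφz (-n)) (hφz (-n))
  have hP : shiftedJacobiSum φ (φ ^ n) ∈ Algebra.adjoin ℤ ({ξ} : Set ℂ) := by
    simpa using hmem (hφz 1) (hφz n)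
  have hcomm : shiftedJacobiSum φ (φ ^ n) = shiftedJacobiSum (φ ^ n) φ :=
    shiftedJacobiSum_comm hneg (by simpa using hnegz n)
  refine ⟨fun hn ↦ ?_, fun d hd hdl hn ↦ ?_, fun hn ↦ ?_⟩
  · have h4 : φ⁻¹ 4 = ξ ^ (-w) := by rw [MulChar.inv_apply_eq_inv', hφ4, zpow_neg]
    -- J(χ, η) = J((χη)⁻¹, η) = J(φ⁻¹, η), to which duplication applies directly.
    rw [hJ, shiftedJacobiSum_eq_inv_mul, hn, ← pow_succ', ← hφ, hχη,
      shiftedJacobiSum_quadratic hF (inv_ne_one.mpr hφne), h4]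
    exact hC1.mul_left (hξmem _)
  · have hln : ¬ l ^ 2 ∣ n := by
      rintro ⟨k, hk⟩
      have hdk : d = l * k := by
        refine Nat.eq_of_mul_eq_mul_right hl.pos ?_
        rw [← hn, hk]
        ring
      obtain ⟨r, hr⟩ := hnodd
      have hk2 : k < 2 := by
        by_contra! hk2
        have := Nat.mul_le_mul_left (l ^ 2) hk2
        omega
      interval_cases k
      · omega
      · exact hdl (by rw [hdk, mul_one])
    have hnz : ((d : ℤ) * l) = n := by rw [hn]; push_cast; rfl
    rw [hnz]
    have hC : CongrInAdjoin ξ ((1 - ξ) ^ (l + 1)) (shiftedJacobiSum φ (φ ^ n))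
        (jacobiFactor l γ ((n : ℤ) - 1) (ξ ^ ((-1 - (n : ℤ)) / 2))) := by
      obtain ⟨r, hr⟩ := hnodd
      have hr' : (-1 - (n : ℤ)) / 2 = -(r + 1) := by
        rw [hr]; push_cast; omega
      have hγr : (φ ^ (-1 - (n : ℤ))) γ = ξ ^ ((-1 - (n : ℤ)) / 2) := by
        rw [hr', MulChar.zpow_apply_coe, mulChar_zpow, ← hφγ2, ← zpow_natCast (φ γ) 2, ← zpow_mul,
          hr]
        congr 1
        push_cast
        ring
      have h := shiftedJacobiSum_congr_jacobiFactor hl hl3 hq2 hγ hξp hγr ((n : ℤ) - 1)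
      -- The base character φ^(-1-n) is chosen so that its (n - 1)-st power is φ^(1-n²) = φ, as l²
      -- divides n².
      have hpow : (φ ^ (-1 - (n : ℤ))) ^ ((n : ℤ) - 1) = φ := by
        have he : (-1 - (n : ℤ)) * ((n : ℤ) - 1) = ((l ^ 2 : ℕ) : ℤ) * (-(d : ℤ) ^ 2) + 1 := by
          rw [← hnz]; push_cast; ring
        rw [← zpow_mul, he, zpow_add, zpow_mul, zpow_natCast, hφ1, one_zpow, one_mul, zpow_one]
      have hinv : (φ ^ (-1 - (n : ℤ)) * φ)⁻¹ = φ ^ n := by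
        rw [← zpow_add_one, ← zpow_neg, ← zpow_natCast]
        congr 1
        ring
      rwa [hpow, shiftedJacobiSum_comm hneg (hnegz _), shiftedJacobiSum_eq_inv_mul, hinv,
        ← hcomm] at h
    -- ξ^n is an l-th root of unity here, so this factor collapses to -1, which gives the sign in
    -- case 2.
    have hCn' := hCn.trans (hn ▸ mul_comm d l ▸
      jacobiFactor_congr_neg_one hl hl3 hξp γ (((l : ℤ) ^ 2 - 1) / 2) d)
    refine CongrInAdjoin.of_card_mul hl hl3 hq2 hξp hXmem ?_
    rw [hred hln]
    have h := (((hC.mul hC1 (jacobiFactor_mem l γ _ (hξmem _)) hP1).mul hCn'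
      (mul_mem (jacobiFactor_mem l γ _ (hξmem _)) (jacobiFactor_mem l γ _ self_mem_adjoin))
      hPn).mul_left (hξmem (-w * ((n : ℤ) + 1))))
    convert h using 1
    ring
  · have hln : ¬ l ^ 2 ∣ n := by
      intro h
      have := Nat.dvd_gcd h (Dvd.intro_left 2 rfl : l ^ 2 ∣ 2 * l ^ 2)
      rw [hn] at this
      have := Nat.le_of_dvd one_pos this
      omega
    have hC : CongrInAdjoin ξ ((1 - ξ) ^ (l + 1)) (shiftedJacobiSum φ (φ ^ n))
        (jacobiFactor l γ (n : ℤ) (ξ ^ ((1 - (l : ℤ) ^ 2) / 2))) := by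
      -- (1 - l²)/2 = -c is congruent to c + 1 mod l².
      have hγc : φ γ = ξ ^ ((1 - (l : ℤ) ^ 2) / 2) := by
        have he : (1 - (l : ℤ) ^ 2) / 2 = ((c + 1 : ℕ) : ℤ) - ((l ^ 2 : ℕ) : ℤ) := by
          push_cast
          omega
        rw [he, zpow_sub₀ hξ0, zpow_natCast, zpow_natCast, hξp.pow_eq_one, div_one, hφγ]
      have h := shiftedJacobiSum_congr_jacobiFactor hl hl3 hq2 hγ hξp hγc (n : ℤ)
      rwa [zpow_natCast, ← hcomm] at h
    refine CongrInAdjoin.of_card_mul hl hl3 hq2 hξp hXmem ?_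
    rw [hred hln]
    have h := (((hC.mul hC1 (jacobiFactor_mem l γ _ (hξmem _)) hP1).mul hCn
      (mul_mem (jacobiFactor_mem l γ _ (hξmem _)) (jacobiFactor_mem l γ _ self_mem_adjoin))
      hPn).mul_left (hξmem (-w * ((n : ℤ) + 1))))
    convert h using 1
    ring
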